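/- For every $n$ consider $n$ workers with parameters $a_i=a_i^{(n)}>0$ and $\mu_i=\mu_i^{(n)}>0$, and a number $r=r_n\in\mathbb N$, such that $a_i=\Theta(1)$ and $\mu_i=\Theta(1)$ uniformly in $i\in[n]$ and $n$, and $r=\Theta(n)$. A load allocation is a vector $\ell=(\ell_1,\dots,\ell_n)$ of non-negative real numbers. Under the allocation $\ell$ the run-times $T_1,\dots,T_n$ of the workers are independent, and for $\ell_i>0$ $$\Pr[T_i\le t]=1-e^{-\frac{\mu_i}{\ell_i}(t-a_i\ell_i)}\qquad (t\ge a_i\ell_i).$$ The aggregate return at time $t$ is $X(t)=\sum_{i=1}^n \ell_i\mathbf 1_{\{T_i\le t\}}$, and the finish time of the allocation is the first time $t\ge 0$ with $X(t)\ge r$ (it is $\infty$ if there is none). Let $\mathbb E[T_{\mathsf{OPT}}]$ be the minimum of the expected finish time over all load allocations, $T_{\mathsf{OPT}}$ being the finish time of a minimizing allocation. Then each equation $e^{\mu_i\lambda}=e^{a_i\mu_i}(\mu_i\lambda+1)$ has a unique positive solution $\lambda_i$, and for every $t>0$ the allocation $\ell^*_i(t)=t/\lambda_i$ is the unique load allocation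 that maximizes $\mathbb E[X(t)]$. Let $X^*(t)$ be the aggregate return at time $t$ under the allocation $\ell^*(t)$. Call a sequence $t_n>0$ feasible if $\Pr[X^*(t_n)<r]=o(1/n)$, and let $t^*=t^*_n$ be a feasible sequence that is minimal up to $o(1)$, i.e. for every feasible sequence $u_n$ and every $\varepsilon>0$ one has $t^*_n\le u_n+\varepsilon$ for all large $n$; such a sequence exists. Let $T_{\mathsf{HCMM}}$ be the finish time of the allocation $\ell_i=t^*/\lambda_i$. Then, for every such $t^*$, $\mathbb E[T_{\mathsf{HCMM}}]$ and $\mathbb E[T_{\mathsf{OPT}}]$ are finite for all large $n$ and $$\lim_{n\to\infty}\bigl(\mathbb E[T_{\mathsf{HCMM}}]-\mathbb E[T_{\mathsf{OPT}}]\bigr)=0 .$$ -/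

import Mathlib

open MeasureTheory ProbabilityTheory Filter Topology
open scoped ENNReal NNReal

noncomputable section

namespace HCMM

/-- Run-times `T i` of workers `i` with shift parameters `a i`, straggling parameters `μ i` and
loads `ℓ i`: they are independent, and a worker with a positive load has a shifted exponential
run-time. (On `t ≥ a i * ℓ i` the formula determines the whole distribution function, since it
vanishes at `t = a i * ℓ i`. A worker with load zero returns no result, so that its run-time is
irrelevant.) -/
structure IsShiftedExpRunTimes {ι Ω : Type*} [MeasurableSpace Ω] (P : Measure Ω)
    (a μ ℓ : ι → ℝ) (T : ι → Ω → ℝ) : Prop where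
  measurable : ∀ i, Measurable (T i)
  indep : iIndepFun T P
  cdf : ∀ i, 0 < ℓ i → ∀ t : ℝ, a i * ℓ i ≤ t →
    P.real {ω | T i ω ≤ t} = 1 - Real.exp (-(μ i / ℓ i) * (t - a i * ℓ i))

/-- The aggregate return at time `t`: the number of inner products received by time `t`, where
worker `i` returns all of its `ℓ i` inner products at its run-time `T i`. -/
def aggregateReturn {ι Ω : Type*} [Fintype ι] (ℓ : ι → ℝ) (T : ι → Ω → ℝ) (t : ℝ) (ω : Ω) : ℝ :=
  ∑ i, {ω' | T i ω' ≤ t}.indicator (fun _ => ℓ i) ω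

/-- The finish time: the first time at which at least `r` inner products have been received
(it is `∞` if this never happens). -/
def finishTime {ι Ω : Type*} [Fintype ι] (r : ℕ) (ℓ : ι → ℝ) (T : ι → Ω → ℝ) (ω : Ω) : ℝ≥0∞ :=
  ⨅ (t : ℝ≥0) (_ : (r : ℝ) ≤ aggregateReturn ℓ T (t : ℝ) ω), (t : ℝ≥0∞)

/-- The expected finish time. -/
def expectedFinishTime {ι Ω : Type*} [Fintype ι] [MeasurableSpace Ω] (P : Measure Ω) (r : ℕ)
    (ℓ : ι → ℝ) (T : ι → Ω → ℝ) : ℝ≥0∞ :=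
  ∫⁻ ω, finishTime r ℓ T ω ∂P

/-! In the following definitions `T ℓ i` is the run-time of worker `i` under the allocation `ℓ`. -/

/-- `ℓ` minimizes the expected finish time over all load allocations. -/
def IsOptimalAllocation {ι Ω : Type*} [Fintype ι] [MeasurableSpace Ω] (P : Measure Ω) (r : ℕ)
    (T : (ι → ℝ) → ι → Ω → ℝ) (ℓ : ι → ℝ) : Prop :=
  (∀ i, 0 ≤ ℓ i) ∧ ∀ m : ι → ℝ, (∀ i, 0 ≤ m i) →
    expectedFinishTime P r ℓ (T ℓ) ≤ expectedFinishTime P r m (T m)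

/-- The optimal value of the problem of minimizing the expected finish time. -/
def optimalExpectedTime {ι Ω : Type*} [Fintype ι] [MeasurableSpace Ω] (P : Measure Ω) (r : ℕ)
    (T : (ι → ℝ) → ι → Ω → ℝ) : ℝ≥0∞ :=
  ⨅ (ℓ : ι → ℝ) (_ : ∀ i, 0 ≤ ℓ i), expectedFinishTime P r ℓ (T ℓ)

/-- First step of the alternative formulation: `ℓ` maximizes the expected aggregate return at
time `t` over all load allocations. -/
def MaximizesReturn {ι Ω : Type*} [Fintype ι] [MeasurableSpace Ω] (P : Measure Ω)
    (T : (ι → ℝ) → ι → Ω → ℝ) (t : ℝ) (ℓ : ι → ℝ) : Prop :=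
  (∀ i, 0 ≤ ℓ i) ∧ ∀ m : ι → ℝ, (∀ i, 0 ≤ m i) →
    ∫ ω, aggregateReturn m (T m) t ω ∂P ≤ ∫ ω, aggregateReturn ℓ (T ℓ) t ω ∂P

/-- `lam` is a positive solution of `exp (μ * lam) = exp (a * μ) * (μ * lam + 1)`. -/
def IsLoadParameter (a μ lam : ℝ) : Prop :=
  0 < lam ∧ Real.exp (μ * lam) = Real.exp (a * μ) * (μ * lam + 1)

/-- The load allocation `t / lam i`. -/
def hcmmLoad {ι : Type*} (lam : ι → ℝ) (t : ℝ) : ι → ℝ := fun i => t / lam i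

/-- The constraint of the second step of the alternative formulation. As it is an asymptotic one,
it concerns a sequence of times `t n`: the probability that fewer than `r n` inner products are
received by time `t n` under the allocation `t n / lam n i` is `o(1 / n)`. -/
def IsFeasibleTime {Ω : ℕ → Type*} [∀ n, MeasurableSpace (Ω n)] (P : ∀ n, Measure (Ω n))
    (r : ℕ → ℕ) (T : ∀ n, (Fin n → ℝ) → Fin n → Ω n → ℝ) (lam : ∀ n, Fin n → ℝ)
    (t : ℕ → ℝ) : Prop :=
  (∀ n, 0 < t n) ∧
    (fun n => (P n).real {ω | aggregateReturn (hcmmLoad (lam n) (t n))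
      (T n (hcmmLoad (lam n) (t n))) (t n) ω < (r n : ℝ)}) =o[atTop] fun n => 1 / (n : ℝ)

/-- Second step of the alternative formulation: `t` is feasible and, up to a vanishing error, not
larger than any feasible sequence of times. -/
def IsMinimalTime {Ω : ℕ → Type*} [∀ n, MeasurableSpace (Ω n)] (P : ∀ n, Measure (Ω n))
    (r : ℕ → ℕ) (T : ∀ n, (Fin n → ℝ) → Fin n → Ω n → ℝ) (lam : ∀ n, Fin n → ℝ)
    (t : ℕ → ℝ) : Prop :=
  IsFeasibleTime P r T lam t ∧
    ∀ u : ℕ → ℝ, IsFeasibleTime P r T lam u → ∀ ε : ℝ, 0 < ε → ∀ᶠ n in atTop, t n ≤ u n + ε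

end HCMM

end

/-! With `s = t / ℓ`, a worker's expected return by time `t` is `t * (1 - exp (-μ * (s - a))) / s`,
which is maximal exactly at `s = lam`, with value `t * μ / (μ * lam + 1)`. So the best expected
total return is `t * R`, where `R = returnRate` is at least of order `n`, and it reaches `r` at the
bounded time `F = fluidTime = r / R`. Both expected finish times turn out to be `F + o(1)`.

A load returned by time `t` is less than `t / a i`, so Hoeffding's inequality holds uniformly over
allocations. Before `F - ε` every allocation falls short of `r` except with probability `exp (-b *
n)` (`eventually_prob_le_exp`). This bounds from below both the optimal expectation and every
feasible sequence. Conversely, `F + (n + 1) ^ (-1/4)` is feasible, hence every minimal `tstar` is `F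
+ o(1)`.

It remains to see that HCMM loses only `o(1)` beyond `tstar`. Failure at `tstar` has probability
`o(1/n)`, so waiting until time `n` in that case costs `o(1)`, and the expected delays of the `n`
workers beyond time `n` are exponentially small (`IsFeasibleTime.eventually_expectedFinishTime_le`).
-/

namespace HCMM

/-! ### The equation for `lam` and the return rate of one worker. -/

section LoadParameter

variable {a μ lam : ℝ}

theorem IsLoadParameter.lt (hμ : 0 < μ) (h : IsLoadParameter a μ lam) : a < lam := by
  obtain ⟨hl, h⟩ := h
  have h1 : Real.exp (a * μ) < Real.exp (μ * lam) := by
    rw [h]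
    nlinarith [Real.exp_pos (a * μ), mul_pos hμ hl]
  have h2 := Real.exp_lt_exp.1 h1
  nlinarith

/-- For `x = μ * lam`, inserting `x + 1 < 2 * exp (x / 2)` into the equation gives `exp (x / 2) ≤ 2
* exp (a * μ)`. -/
theorem IsLoadParameter.mul_le (hμ : 0 < μ) (h : IsLoadParameter a μ lam) :
    μ * lam ≤ 4 * Real.exp (a * μ) := by
  obtain ⟨hl, h⟩ := h
  have hx : 0 < μ * lam := mul_pos hμ hl
  have h1 := Real.add_one_le_exp (μ * lam / 2)
  have h2 : Real.exp (μ * lam) = Real.exp (μ * lam / 2) * Real.exp (μ * lam / 2) := by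
    rw [← Real.exp_add]; ring_nf
  have h3 : Real.exp (μ * lam / 2) ≤ 2 * Real.exp (a * μ) := by
    by_contra! hlt
    nlinarith [Real.exp_pos (a * μ), Real.exp_pos (μ * lam / 2)]
  linarith

/-- In logarithmic form the left side `μ * x - log (μ * x + 1)` increases strictly from `0` without
bound. -/
theorem existsUnique_isLoadParameter (ha : 0 < a) (hμ : 0 < μ) :
    ∃! x : ℝ, IsLoadParameter a μ x := by
  have key : ∀ x : ℝ, 0 < x →
      (IsLoadParameter a μ x ↔ μ * x - Real.log (μ * x + 1) = a * μ) := by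
    intro x hx
    have h1 : 0 < μ * x + 1 := by positivity
    have h2 : Real.exp (a * μ) * (μ * x + 1) = Real.exp (a * μ + Real.log (μ * x + 1)) := by
      rw [Real.exp_add, Real.exp_log h1]
    simp only [IsLoadParameter, hx, true_and]
    rw [h2, Real.exp_eq_exp]
    constructor <;> intro h <;> linarith
  have mono : ∀ x y : ℝ, 0 < x → x < y →
      μ * x - Real.log (μ * x + 1) < μ * y - Real.log (μ * y + 1) := by
    intro x y hx hxy
    have h1 : 0 < μ * x + 1 := by positivity
    have h2 : 0 < μ * y + 1 := by have := hx.trans hxy; positivity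
    have h3 := Real.log_le_sub_one_of_pos (div_pos h2 h1)
    rw [Real.log_div h2.ne' h1.ne'] at h3
    have h4 : (μ * y + 1) / (μ * x + 1) - 1 < μ * (y - x) := by
      rw [div_sub_one h1.ne', div_lt_iff₀ h1]
      nlinarith [mul_pos (mul_pos hμ (sub_pos.2 hxy)) (mul_pos hμ hx)]
    linarith
  have hcont : ContinuousOn (fun x : ℝ => μ * x - Real.log (μ * x + 1)) (Set.Ici 0) := by
    refine ContinuousOn.sub (by fun_prop) (ContinuousOn.log (by fun_prop) fun x hx => ?_)
    have : 0 ≤ μ * x := mul_nonneg hμ.le hx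
    linarith
  obtain ⟨x, hx, hfx⟩ : ∃ x : ℝ, 0 ≤ x ∧ μ * x - Real.log (μ * x + 1) = a * μ := by
    -- Applying `log y ≤ y - 1` to `y = (μ * b + 1) / 2` halves the slope, so half of `μ * b`
    -- survives the subtraction of the logarithm.
    set b : ℝ := (2 * (a * μ) + 2) / μ with hb
    have hb0 : 0 ≤ b := by positivity
    have hbμ : μ * b = 2 * (a * μ) + 2 := by rw [hb]; field_simp
    have hlog : Real.log (μ * b + 1) ≤ a * μ + 2 := by
      have h1 : 0 < (μ * b + 1) / 2 := by rw [hbμ]; positivity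
      have h3 := Real.log_le_sub_one_of_pos h1
      rw [Real.log_div (by rw [hbμ]; positivity) two_ne_zero] at h3
      have := Real.log_two_lt_d9
      linarith
    have := intermediate_value_Icc hb0 (hcont.mono Set.Icc_subset_Ici_self)
    obtain ⟨x, hx, hfx⟩ := this (show a * μ ∈ Set.Icc _ _ from
      ⟨by simp; positivity, by
        show _ ≤ μ * b - Real.log (μ * b + 1)
        linarith⟩)
    exact ⟨x, hx.1, hfx⟩
  have hx0 : 0 < x := by
    rcases hx.eq_or_lt with h | h
    · subst h; simp at hfx; rcases hfx with h | h <;> linarith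
    · exact h
  refine ⟨x, (key x hx0).2 hfx, fun y hy => ?_⟩
  have hfy := (key y hy.1).1 hy
  rcases lt_trichotomy x y with h | h | h
  · have := mono x y hx0 h; linarith
  · exact h.symm
  · have := mono y x hy.1 h; linarith

/-- The return rate `(1 - exp (-μ * (s - a))) / s` is strictly maximal at `s = lam`. -/
theorem IsLoadParameter.one_sub_exp_lt (hμ : 0 < μ) (h : IsLoadParameter a μ lam) {s : ℝ}
    (hs : s ≠ lam) : 1 - Real.exp (-μ * (s - a)) < s * (μ / (μ * lam + 1)) := by
  have hl := h.1
  have h1 : 0 < μ * lam + 1 := by positivity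
  -- The equation for `lam` recentres the exponential at `lam`; what remains is the strict tangent
  -- inequality `1 + y < exp y` with `y = -(μ * (s - lam)) ≠ 0`.
  have h2 : Real.exp (-μ * (s - a)) * (μ * lam + 1) = Real.exp (-(μ * (s - lam))) := by
    have h3 : Real.exp (-μ * (s - a)) = Real.exp (-(μ * s)) * Real.exp (a * μ) := by
      rw [← Real.exp_add]; ring_nf
    rw [h3, mul_assoc, ← h.2, ← Real.exp_add]; ring_nf
  have h3 := Real.add_one_lt_exp (x := -(μ * (s - lam)))
    (neg_ne_zero.2 (mul_ne_zero hμ.ne' (sub_ne_zero.2 hs)))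
  rw [← h2] at h3
  rw [← mul_div_assoc, lt_div_iff₀ h1]
  linarith

theorem IsLoadParameter.one_sub_exp_eq (hμ : 0 < μ) (h : IsLoadParameter a μ lam) :
    1 - Real.exp (-μ * (lam - a)) = lam * (μ / (μ * lam + 1)) := by
  have hl := h.1
  have h1 : 0 < μ * lam + 1 := by positivity
  have h2 : Real.exp (-μ * (lam - a)) * (μ * lam + 1) = 1 := by
    have h3 : Real.exp (-μ * (lam - a)) = Real.exp (-(μ * lam)) * Real.exp (a * μ) := by
      rw [← Real.exp_add]; ring_nf
    rw [h3, mul_assoc, ← h.2, ← Real.exp_add]; simp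
  rw [← mul_div_assoc, eq_div_iff h1.ne']
  linarith

end LoadParameter

theorem hcmmLoad_nonneg {ι : Type*} {lam : ι → ℝ} (hlam : ∀ i, 0 < lam i) {t : ℝ} (ht : 0 ≤ t) (i : ι) :
    0 ≤ hcmmLoad lam t i :=
  div_nonneg ht (hlam i).le

/-! ### Estimates for a single worker. -/

section RunTimes

variable {ι Ω : Type*} [MeasurableSpace Ω] {P : Measure Ω} {a μ ℓ : ι → ℝ} {T : ι → Ω → ℝ}

theorem IsShiftedExpRunTimes.ae_lt [IsProbabilityMeasure P] (h : IsShiftedExpRunTimes P a μ ℓ T)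
    {i : ι} (hi : 0 < ℓ i) : ∀ᵐ ω ∂P, a i * ℓ i < T i ω := by
  have h1 := h.cdf i hi _ le_rfl
  simp only [sub_self, mul_zero, Real.exp_zero] at h1
  have h2 := (measureReal_eq_zero_iff).1 h1
  rw [ae_iff]
  simpa using h2

theorem IsShiftedExpRunTimes.load_mul_prob_eq [IsProbabilityMeasure P]
    (h : IsShiftedExpRunTimes P a μ ℓ T) {i : ι} {lam t : ℝ} (hμ : 0 < μ i) (ht : 0 < t)
    (hlam : IsLoadParameter (a i) (μ i) lam) (hℓ : ℓ i = t / lam) :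
    ℓ i * P.real {ω | T i ω ≤ t} = t * (μ i / (μ i * lam + 1)) := by
  have hl := hlam.1
  have hpos : 0 < ℓ i := by rw [hℓ]; positivity
  have hlt : a i * ℓ i ≤ t := by
    rw [hℓ, ← mul_div_assoc, div_le_iff₀ hl]
    nlinarith [hlam.lt hμ]
  rw [h.cdf i hpos t hlt]
  have h1 : -(μ i / ℓ i) * (t - a i * ℓ i) = -μ i * (lam - a i) := by
    rw [hℓ]; field_simp
  rw [h1, hlam.one_sub_exp_eq hμ, hℓ]
  field_simp

theorem IsShiftedExpRunTimes.load_mul_prob_lt [IsProbabilityMeasure P]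
    (h : IsShiftedExpRunTimes P a μ ℓ T) {i : ι} {lam t : ℝ} (hμ : 0 < μ i) (ht : 0 < t)
    (hlam : IsLoadParameter (a i) (μ i) lam) (hℓ0 : 0 ≤ ℓ i) (hℓ : ℓ i ≠ t / lam) :
    ℓ i * P.real {ω | T i ω ≤ t} < t * (μ i / (μ i * lam + 1)) := by
  have hl := hlam.1
  have hκ : 0 < t * (μ i / (μ i * lam + 1)) := by positivity
  rcases hℓ0.eq_or_lt with h0 | hpos
  · rw [← h0, zero_mul]; exact hκ
  rcases le_or_gt (a i * ℓ i) t with hle | hgt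
  · rw [h.cdf i hpos t hle]
    have h1 : -(μ i / ℓ i) * (t - a i * ℓ i) = -μ i * (t / ℓ i - a i) := by
      field_simp
    have hne : t / ℓ i ≠ lam := by
      rintro rfl
      apply hℓ
      field_simp
    have h2 := hlam.one_sub_exp_lt hμ hne
    rw [h1]
    calc _ < ℓ i * (t / ℓ i * (μ i / (μ i * lam + 1))) := by gcongr
      _ = _ := by field_simp
  · have h0 : P {ω | T i ω ≤ t} = 0 := by
      have := h.ae_lt hpos
      rw [ae_iff] at this
      exact measure_mono_null (fun ω hω => not_lt.2 (le_trans hω hgt.le)) this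
    rw [measureReal_def, h0]
    simpa using hκ

theorem IsShiftedExpRunTimes.load_mul_prob_le [IsProbabilityMeasure P]
    (h : IsShiftedExpRunTimes P a μ ℓ T) {i : ι} {lam t : ℝ} (hμ : 0 < μ i) (ht : 0 < t)
    (hlam : IsLoadParameter (a i) (μ i) lam) (hℓ0 : 0 ≤ ℓ i) :
    ℓ i * P.real {ω | T i ω ≤ t} ≤ t * (μ i / (μ i * lam + 1)) := by
  by_cases hℓ : ℓ i = t / lam
  · exact (h.load_mul_prob_eq hμ ht hlam hℓ).le
  · exact (h.load_mul_prob_lt hμ ht hlam hℓ0 hℓ).le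

/-- The expected time that worker `i` is late after `M`. -/
theorem IsShiftedExpRunTimes.lintegral_sub_le [IsProbabilityMeasure P]
    (h : IsShiftedExpRunTimes P a μ ℓ T) {i : ι} (hμ : 0 < μ i) (hℓ : 0 < ℓ i) {M : ℝ}
    (hM : a i * ℓ i ≤ M) :
    ∫⁻ ω, ENNReal.ofReal (T i ω - M) ∂P ≤
      ENNReal.ofReal (ℓ i / μ i * Real.exp (-(μ i / ℓ i) * (M - a i * ℓ i))) := by
  have hmeas := h.measurable i
  have hb : 0 < μ i / ℓ i := by positivity
  -- `ENNReal.ofReal` already truncates at `0`; the explicit maximum supplies the nonnegative real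
  -- function for the layer-cake formula.
  have h1 : ∫⁻ ω, ENNReal.ofReal (T i ω - M) ∂P = ∫⁻ ω, ENNReal.ofReal (max (T i ω - M) 0) ∂P := by
    simp
  rw [h1, lintegral_eq_lintegral_meas_lt P (f := fun ω => max (T i ω - M) 0)
    (ae_of_all _ fun ω => le_max_right _ _) (by fun_prop)]
  have h2 : ∀ t ∈ Set.Ioi (0 : ℝ), P {ω | t < max (T i ω - M) 0} =
      ENNReal.ofReal (Real.exp (-(μ i / ℓ i) * (M - a i * ℓ i)) *
        Real.exp (-(μ i / ℓ i) * t)) := by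
    intro t ht
    have ht : 0 < t := ht
    have h3 : {ω | t < max (T i ω - M) 0} = {ω | T i ω ≤ M + t}ᶜ := by
      ext ω
      simp only [Set.mem_ofPred_eq, Set.mem_compl_iff, lt_max_iff, not_le]
      constructor
      · rintro (h | h) <;> linarith
      · intro h; left; linarith
    have h4 := h.cdf i hℓ (M + t) (by linarith)
    rw [h3, ← ofReal_measureReal, probReal_compl_eq_one_sub
      (measurableSet_le hmeas measurable_const), h4, ← Real.exp_add]
    congr 1
    ring_nf
  rw [setLIntegral_congr_fun measurableSet_Ioi h2, ← ofReal_integral_eq_lintegral_ofReal]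
  · rw [integral_const_mul, integral_exp_mul_Ioi (by linarith)]
    apply ENNReal.ofReal_le_ofReal
    apply le_of_eq
    simp
    field_simp
  · exact (integrableOn_exp_mul_Ioi (by linarith) 0).const_mul _
  · exact ae_of_all _ fun t => by positivity

/-- The contribution of each worker to the return at time `t` is sub-Gaussian, since only loads up
to `t / c` can have been processed. -/
theorem IsShiftedExpRunTimes.hasSubgaussianMGF [IsProbabilityMeasure P]
    (h : IsShiftedExpRunTimes P a μ ℓ T) (hℓ : ∀ i, 0 ≤ ℓ i) {c : ℝ} (hc : 0 < c)
    (ha : ∀ i, c ≤ a i) {t : ℝ} (ht : 0 ≤ t) (i : ι) :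
    HasSubgaussianMGF
      (fun ω => {ω' | T i ω' ≤ t}.indicator (fun _ => ℓ i) ω - ℓ i * P.real {ω | T i ω ≤ t})
      ((‖t / c - 0‖₊ / 2) ^ 2) P := by
  have hS : MeasurableSet {ω | T i ω ≤ t} := measurableSet_le (h.measurable i) measurable_const
  have hint : ∫ ω, {ω' | T i ω' ≤ t}.indicator (fun _ => ℓ i) ω ∂P =
      ℓ i * P.real {ω | T i ω ≤ t} := by
    rw [integral_indicator_const _ hS, smul_eq_mul, mul_comm]
  rw [← hint]
  refine hasSubgaussianMGF_of_mem_Icc (measurable_const.indicator hS).aemeasurable ?_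
  rcases (hℓ i).eq_or_lt with h0 | hpos
  · refine ae_of_all _ fun ω => ?_
    rw [← h0]
    simpa using div_nonneg ht hc.le
  · filter_upwards [h.ae_lt hpos] with ω hω
    refine ⟨Set.indicator_nonneg (fun _ _ => hℓ i) ω, ?_⟩
    by_cases hT : T i ω ≤ t
    · rw [Set.indicator_of_mem (by exact hT), le_div_iff₀ hc]
      nlinarith [ha i]
    · rw [Set.indicator_of_notMem (by exact hT)]
      exact div_nonneg ht hc.le

theorem IsShiftedExpRunTimes.iIndepFun_indicator
    (h : IsShiftedExpRunTimes P a μ ℓ T) (t : ℝ) (d : ι → ℝ) :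
    iIndepFun (fun i ω => {ω' | T i ω' ≤ t}.indicator (fun _ => ℓ i) ω - d i) P := by
  exact h.indep.comp (fun i x => (Set.Iic t).indicator (fun _ => ℓ i) x - d i) fun i =>
    (measurable_const.indicator measurableSet_Iic).sub_const _

end RunTimes

/-! ### Finish time, optimal expected return and concentration. -/

section AggregateReturn

variable {ι Ω : Type*} [Fintype ι] {ℓ : ι → ℝ} {T : ι → Ω → ℝ}

theorem aggregateReturn_mono (hℓ : ∀ i, 0 ≤ ℓ i) (ω : Ω) :
    Monotone fun t => aggregateReturn ℓ T t ω := by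
  intro s t hst
  refine Finset.sum_le_sum fun i _ => ?_
  exact Set.indicator_le_indicator_of_subset (fun ω (hω : T i ω ≤ s) => hω.trans hst)
    (fun _ => hℓ i) ω

theorem aggregateReturn_le_sum (hℓ : ∀ i, 0 ≤ ℓ i) (t : ℝ) (ω : Ω) :
    aggregateReturn ℓ T t ω ≤ ∑ i, ℓ i :=
  Finset.sum_le_sum fun i _ => Set.indicator_le_self' (fun _ _ => hℓ i) ω

theorem finishTime_le {r : ℕ} {t : ℝ} (ht : 0 ≤ t) {ω : Ω}
    (h : (r : ℝ) ≤ aggregateReturn ℓ T t ω) : finishTime r ℓ T ω ≤ ENNReal.ofReal t :=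
  iInf₂_le (t.toNNReal) (by rwa [Real.coe_toNNReal t ht])

theorem le_finishTime {r : ℕ} (hℓ : ∀ i, 0 ≤ ℓ i) {t : ℝ} {ω : Ω}
    (h : aggregateReturn ℓ T t ω < r) : ENNReal.ofReal t ≤ finishTime r ℓ T ω := by
  refine le_iInf₂ fun s hs => ?_
  have : t ≤ s := by
    by_contra! hlt
    exact absurd (hs.trans (aggregateReturn_mono hℓ ω hlt.le)) (not_le.2 h)
  simpa using ENNReal.ofReal_le_ofReal this

/-- Up to time `t`, or up to time `M` if the return is late, and then until the last worker has
finished. -/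
theorem finishTime_le_add {r : ℕ} (hsum : (r : ℝ) ≤ ∑ i, ℓ i) {t M : ℝ} (ht : 0 ≤ t)
    (hM : 0 ≤ M) (ω : Ω) :
    finishTime r ℓ T ω ≤ ENNReal.ofReal t +
      {ω | aggregateReturn ℓ T t ω < r}.indicator (fun _ => ENNReal.ofReal M) ω +
      ∑ i, ENNReal.ofReal (T i ω - M) := by
  by_cases h : aggregateReturn ℓ T t ω < r
  · have hs : ∀ i, 0 ≤ max (T i ω - M) 0 := fun i => le_max_right _ _
    -- The sum of the delays after `M` dominates each of them, so every worker is done by this time.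
    have h1 : finishTime r ℓ T ω ≤ ENNReal.ofReal (M + ∑ i, max (T i ω - M) 0) := by
      refine finishTime_le (add_nonneg hM (Finset.sum_nonneg fun i _ => hs i)) ?_
      refine hsum.trans (Finset.sum_le_sum fun i _ => ?_)
      rw [Set.indicator_of_mem]
      have h1 := Finset.single_le_sum (f := fun i => max (T i ω - M) 0) (fun i _ => hs i)
        (Finset.mem_univ i)
      have h2 := le_max_left (T i ω - M) 0
      simp only [Set.mem_ofPred_eq]
      linarith
    rw [ENNReal.ofReal_add hM (Finset.sum_nonneg fun i _ => hs i),
      ENNReal.ofReal_sum_of_nonneg fun i _ => hs i] at h1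
    simp only [ENNReal.ofReal_max, ENNReal.ofReal_zero, zero_le, sup_of_le_left] at h1
    rw [Set.indicator_of_mem (by exact h)]
    exact h1.trans (add_le_add_left le_add_self _)
  · rw [add_assoc]
    exact (finishTime_le ht (not_lt.1 h)).trans le_self_add

variable [MeasurableSpace Ω] {P : Measure Ω} {a μ : ι → ℝ}

theorem measurable_aggregateReturn (hT : ∀ i, Measurable (T i)) (t : ℝ) :
    Measurable (aggregateReturn ℓ T t) :=
  Finset.measurable_fun_sum _ fun i _ =>
    measurable_const.indicator (measurableSet_le (hT i) measurable_const)

theorem integral_aggregateReturn [IsProbabilityMeasure P] (hT : ∀ i, Measurable (T i)) (t : ℝ) :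
    ∫ ω, aggregateReturn ℓ T t ω ∂P = ∑ i, ℓ i * P.real {ω | T i ω ≤ t} := by
  have hS : ∀ i, MeasurableSet {ω | T i ω ≤ t} := fun i =>
    measurableSet_le (hT i) measurable_const
  simp only [aggregateReturn]
  rw [integral_finsetSum _ fun i _ => (integrable_const _).indicator (hS i)]
  refine Finset.sum_congr rfl fun i _ => ?_
  rw [integral_indicator_const _ (hS i), smul_eq_mul, mul_comm]

theorem IsShiftedExpRunTimes.integral_aggregateReturn_le [IsProbabilityMeasure P]
    (h : IsShiftedExpRunTimes P a μ ℓ T) (hμ : ∀ i, 0 < μ i) {lam : ι → ℝ}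
    (hlam : ∀ i, IsLoadParameter (a i) (μ i) (lam i)) {t : ℝ} (ht : 0 < t) (hℓ : ∀ i, 0 ≤ ℓ i) :
    ∫ ω, aggregateReturn ℓ T t ω ∂P ≤ t * ∑ i, μ i / (μ i * lam i + 1) := by
  rw [integral_aggregateReturn h.measurable, Finset.mul_sum]
  exact Finset.sum_le_sum fun i _ => h.load_mul_prob_le (hμ i) ht (hlam i) (hℓ i)

theorem IsShiftedExpRunTimes.integral_aggregateReturn_eq_iff [IsProbabilityMeasure P]
    (h : IsShiftedExpRunTimes P a μ ℓ T) (hμ : ∀ i, 0 < μ i) {lam : ι → ℝ}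
    (hlam : ∀ i, IsLoadParameter (a i) (μ i) (lam i)) {t : ℝ} (ht : 0 < t) (hℓ : ∀ i, 0 ≤ ℓ i) :
    ∫ ω, aggregateReturn ℓ T t ω ∂P = t * ∑ i, μ i / (μ i * lam i + 1) ↔
      ℓ = hcmmLoad lam t := by
  rw [integral_aggregateReturn h.measurable, Finset.mul_sum,
    Finset.sum_eq_sum_iff_of_le fun i _ => h.load_mul_prob_le (hμ i) ht (hlam i) (hℓ i)]
  constructor
  · intro heq
    funext i
    by_contra hne
    exact (h.load_mul_prob_lt (hμ i) ht (hlam i) (hℓ i) hne).ne (heq i (Finset.mem_univ i))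
  · rintro rfl i -
    exact h.load_mul_prob_eq (hμ i) ht (hlam i) rfl

theorem maximizesReturn_iff [IsProbabilityMeasure P] {T : (ι → ℝ) → ι → Ω → ℝ}
    (hT : ∀ ℓ : ι → ℝ, (∀ i, 0 ≤ ℓ i) → IsShiftedExpRunTimes P a μ ℓ (T ℓ))
    (hμ : ∀ i, 0 < μ i) {lam : ι → ℝ} (hlam : ∀ i, IsLoadParameter (a i) (μ i) (lam i))
    {t : ℝ} (ht : 0 < t) : MaximizesReturn P T t ℓ ↔ ℓ = hcmmLoad lam t := by
  have hc := hcmmLoad_nonneg (fun i => (hlam i).1) ht.le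
  have heq := ((hT _ hc).integral_aggregateReturn_eq_iff hμ hlam ht hc).2 rfl
  constructor
  · rintro ⟨h0, hmax⟩
    refine ((hT ℓ h0).integral_aggregateReturn_eq_iff hμ hlam ht h0).1 (le_antisymm ?_ ?_)
    · exact (hT ℓ h0).integral_aggregateReturn_le hμ hlam ht h0
    · exact heq ▸ hmax _ hc
  · rintro rfl
    exact ⟨hc, fun m hm => heq ▸ (hT m hm).integral_aggregateReturn_le hμ hlam ht hm⟩

/-- Hoeffding's bound with variance proxy `(t / (2 * c)) ^ 2` per worker, whatever the size of the
loads. -/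
theorem IsShiftedExpRunTimes.measureReal_add_le_aggregateReturn_le [IsProbabilityMeasure P]
    (h : IsShiftedExpRunTimes P a μ ℓ T) (hℓ : ∀ i, 0 ≤ ℓ i) {c : ℝ} (hc : 0 < c)
    (ha : ∀ i, c ≤ a i) {t : ℝ} (ht : 0 ≤ t) {s : ℝ} (hs : 0 ≤ s) :
    P.real {ω | ∫ ω, aggregateReturn ℓ T t ω ∂P + s ≤ aggregateReturn ℓ T t ω} ≤
      Real.exp (-(2 * c ^ 2 * s ^ 2 / (Fintype.card ι * t ^ 2))) := by
  have h1 := HasSubgaussianMGF.measure_sum_ge_le_of_iIndepFun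
    (h.iIndepFun_indicator t _) (s := Finset.univ)
    (fun i _ => h.hasSubgaussianMGF hℓ hc ha ht i) hs
  rw [integral_aggregateReturn h.measurable]
  convert h1 using 2
  · ext ω
    simp only [aggregateReturn, Finset.sum_sub_distrib, Set.mem_ofPred_eq]
    constructor <;> intro h <;> linarith
  · simp [Finset.sum_const, div_pow]
    field_simp

theorem IsShiftedExpRunTimes.measureReal_aggregateReturn_le_sub_le [IsProbabilityMeasure P]
    (h : IsShiftedExpRunTimes P a μ ℓ T) (hℓ : ∀ i, 0 ≤ ℓ i) {c : ℝ} (hc : 0 < c)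
    (ha : ∀ i, c ≤ a i) {t : ℝ} (ht : 0 ≤ t) {s : ℝ} (hs : 0 ≤ s) :
    P.real {ω | aggregateReturn ℓ T t ω ≤ ∫ ω, aggregateReturn ℓ T t ω ∂P - s} ≤
      Real.exp (-(2 * c ^ 2 * s ^ 2 / (Fintype.card ι * t ^ 2))) := by
  have h1 := HasSubgaussianMGF.measure_sum_ge_le_of_iIndepFun
    ((h.iIndepFun_indicator t _).comp (fun _ x => -x) fun _ => measurable_neg) (s := Finset.univ)
    (fun i _ => (h.hasSubgaussianMGF hℓ hc ha ht i).neg) hs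
  rw [integral_aggregateReturn h.measurable]
  convert h1 using 2
  · ext ω
    simp only [aggregateReturn, Function.comp, Finset.sum_neg_distrib, Finset.sum_sub_distrib,
      Set.mem_ofPred_eq]
    constructor <;> intro h <;> linarith
  · simp [Finset.sum_const, div_pow]
    field_simp

end AggregateReturn

end HCMM
-- Asymptotics around the fluid time.
namespace HCMM

/-- The maximal expected return per unit of time. -/
noncomputable def returnRate {ι : Type*} [Fintype ι] (μ lam : ι → ℝ) : ℝ :=
  ∑ i, μ i / (μ i * lam i + 1)

/-- The time at which the maximal expected return is `r`. -/
noncomputable def fluidTime {ι : Type*} [Fintype ι] (r : ℕ) (μ lam : ι → ℝ) : ℝ :=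
  r / returnRate μ lam

theorem isLittleO_one_div_nat_iff {f : ℕ → ℝ} :
    (f =o[atTop] fun n : ℕ => 1 / (n : ℝ)) ↔ Tendsto (fun n : ℕ => (n : ℝ) * f n) atTop (𝓝 0) := by
  rw [Asymptotics.isLittleO_iff_tendsto']
  · simp [div_eq_mul_inv, mul_comm]
  · filter_upwards [eventually_ge_atTop 1] with n hn h
    have : (0 : ℝ) < n := by exact_mod_cast hn
    simp at h
    omega

theorem tendsto_nat_mul_exp_neg {b : ℝ} (hb : 0 < b) :
    Tendsto (fun n : ℕ => (n : ℝ) * Real.exp (-(b * n))) atTop (𝓝 0) := by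
  have h1 : Tendsto (fun n : ℕ => b * (n : ℝ)) atTop atTop :=
    tendsto_natCast_atTop_atTop.const_mul_atTop hb
  have h2 := ((Real.tendsto_pow_mul_exp_neg_atTop_nhds_zero 1).comp h1).const_mul b⁻¹
  rw [mul_zero] at h2
  refine h2.congr fun n => ?_
  simp only [Function.comp, pow_one]
  field_simp

theorem tendsto_exp_neg_nat {b : ℝ} (hb : 0 < b) :
    Tendsto (fun n : ℕ => Real.exp (-(b * n))) atTop (𝓝 0) :=
  Real.tendsto_exp_neg_atTop_nhds_zero.comp
    (tendsto_natCast_atTop_atTop.const_mul_atTop hb)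

theorem tendsto_nat_mul_exp_neg_sqrt {b : ℝ} (hb : 0 < b) :
    Tendsto (fun n : ℕ => (n : ℝ) * Real.exp (-(b * √(n + 1)))) atTop (𝓝 0) := by
  have h0 : Tendsto (fun n : ℕ => (n : ℝ) + 1) atTop atTop :=
    tendsto_atTop_add_const_right _ _ tendsto_natCast_atTop_atTop
  have h1 : Tendsto (fun n : ℕ => b * √((n : ℝ) + 1)) atTop atTop :=
    (Real.tendsto_sqrt_atTop.comp h0).const_mul_atTop hb
  have h2 := ((Real.tendsto_pow_mul_exp_neg_atTop_nhds_zero 2).comp h1).const_mul (b ^ 2)⁻¹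
  rw [mul_zero] at h2
  refine squeeze_zero (fun n => by positivity) (fun n => ?_) h2
  simp only [Function.comp, mul_pow]
  rw [Real.sq_sqrt (by positivity), ← mul_assoc, inv_mul_cancel_left₀ (by positivity)]
  gcongr
  linarith

section Sequences

variable {a μ lam : ∀ n, Fin n → ℝ} {r : ℕ → ℕ}

theorem exists_mul_le_returnRate
    (ha : ∃ c C : ℝ, 0 < c ∧ ∀ n i, c ≤ a n i ∧ a n i ≤ C)
    (hμ : ∃ c C : ℝ, 0 < c ∧ ∀ n i, c ≤ μ n i ∧ μ n i ≤ C)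
    (hlam : ∀ n i, IsLoadParameter (a n i) (μ n i) (lam n i)) :
    ∃ k : ℝ, 0 < k ∧ ∀ n, k * n ≤ returnRate (μ n) (lam n) := by
  obtain ⟨c, C, hc, ha⟩ := ha
  obtain ⟨d, D, hd, hμ⟩ := hμ
  refine ⟨d / (4 * Real.exp (C * D) + 1), by positivity, fun n => ?_⟩
  have h : ∀ i ∈ (Finset.univ : Finset (Fin n)), d / (4 * Real.exp (C * D) + 1) ≤
      μ n i / (μ n i * lam n i + 1) := by
    intro i _
    have hμi : 0 < μ n i := hd.trans_le (hμ n i).1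
    have hai : 0 < a n i := hc.trans_le (ha n i).1
    have h1 := (hlam n i).mul_le hμi
    have h2 : Real.exp (a n i * μ n i) ≤ Real.exp (C * D) := by
      apply Real.exp_le_exp.2
      exact mul_le_mul (ha n i).2 (hμ n i).2 hμi.le (hai.le.trans (ha n i).2)
    have h3 := mul_pos hμi (hlam n i).1
    exact div_le_div₀ hμi.le (hμ n i).1 (by linarith) (by linarith)
  have := Finset.card_nsmul_le_sum _ _ _ h
  simpa [returnRate, mul_comm] using this

variable {k : ℝ}

theorem fluidTime_nonneg (hk : 0 < k) (hK : ∀ n, k * n ≤ returnRate (μ n) (lam n)) (n : ℕ) :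
    0 ≤ fluidTime (r n) (μ n) (lam n) :=
  div_nonneg (Nat.cast_nonneg _) (le_trans (by positivity) (hK n))

theorem exists_fluidTime_le (hk : 0 < k) (hK : ∀ n, k * n ≤ returnRate (μ n) (lam n))
    (hr : (fun n => (r n : ℝ)) =Θ[atTop] fun n => (n : ℝ)) :
    ∃ τ : ℝ, 0 < τ ∧ ∀ᶠ n in atTop, fluidTime (r n) (μ n) (lam n) ≤ τ := by
  obtain ⟨C, hC, hrC⟩ := hr.1.exists_pos
  refine ⟨C / k, by positivity, ?_⟩
  filter_upwards [hrC.bound, eventually_ge_atTop 1] with n hn h1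
  have h1 : (0 : ℝ) < n := by exact_mod_cast h1
  simp only [Real.norm_natCast] at hn
  have h2 : 0 < k * n := by positivity
  rw [fluidTime, div_le_div_iff₀ (h2.trans_le (hK n)) hk]
  nlinarith [hK n]

theorem fluidTime_mul_returnRate (hk : 0 < k) (hK : ∀ n, k * n ≤ returnRate (μ n) (lam n))
    {n : ℕ} (hn : 1 ≤ n) :
    fluidTime (r n) (μ n) (lam n) * returnRate (μ n) (lam n) = r n := by
  have h1 : (0 : ℝ) < n := by exact_mod_cast hn
  have h2 : 0 < k * n := by positivity
  exact div_mul_cancel₀ _ (h2.trans_le (hK n)).ne'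

variable {Ω : ℕ → Type*} [∀ n, MeasurableSpace (Ω n)] {P : ∀ n, Measure (Ω n)}
  [∀ n, IsProbabilityMeasure (P n)] {T : ∀ n, (Fin n → ℝ) → Fin n → Ω n → ℝ} {c τ : ℝ}

/-- No allocation is likely to return `r n` inner products noticeably before the fluid time. -/
theorem eventually_prob_le_exp (hc : 0 < c) (hac : ∀ n i, c ≤ a n i) (hμ : ∀ n i, 0 < μ n i)
    (hlam : ∀ n i, IsLoadParameter (a n i) (μ n i) (lam n i))
    (hT : ∀ n (ℓ : Fin n → ℝ), (∀ i, 0 ≤ ℓ i) →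
      IsShiftedExpRunTimes (P n) (a n) (μ n) ℓ (T n ℓ))
    (hk : 0 < k) (hK : ∀ n, k * n ≤ returnRate (μ n) (lam n))
    (hτ : 0 < τ) (hle : ∀ᶠ n in atTop, fluidTime (r n) (μ n) (lam n) ≤ τ)
    {ε : ℝ} (hε : 0 < ε) :
    ∃ b : ℝ, 0 < b ∧ ∀ᶠ n in atTop, ∀ ℓ : Fin n → ℝ, (∀ i, 0 ≤ ℓ i) → ∀ t : ℝ, 0 < t →
      t ≤ fluidTime (r n) (μ n) (lam n) - ε →
      (P n).real {ω | (r n : ℝ) ≤ aggregateReturn ℓ (T n ℓ) t ω} ≤ Real.exp (-(b * n)) := by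
  -- The mean is at most `r - ε * R` and `R ≥ k * n`, so this is Hoeffding's exponent for deviation
  -- `ε * k * n` and time at most `τ`, divided by `n`.
  refine ⟨2 * c ^ 2 * (ε * k) ^ 2 / τ ^ 2, by positivity, ?_⟩
  filter_upwards [hle, eventually_ge_atTop 1] with n hn h1 ℓ hℓ t ht htle
  have hn0 : (0 : ℝ) < n := by exact_mod_cast h1
  have hrK := fluidTime_mul_returnRate (r := r) hk hK h1
  have hK0 : 0 < returnRate (μ n) (lam n) := lt_of_lt_of_le (by positivity) (hK n)
  have hmean := (hT n ℓ hℓ).integral_aggregateReturn_le (hμ n) (hlam n) ht hℓ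
  change _ ≤ t * returnRate (μ n) (lam n) at hmean
  have htail := (hT n ℓ hℓ).measureReal_add_le_aggregateReturn_le hℓ hc (hac n) ht.le
    (s := ε * returnRate (μ n) (lam n)) (by positivity)
  refine (measureReal_mono fun ω (hω : (r n : ℝ) ≤ _) => ?_).trans
    (htail.trans (Real.exp_le_exp.2 (neg_le_neg ?_)))
  · refine le_trans ?_ hω
    nlinarith
  · rw [Fintype.card_fin]
    calc 2 * c ^ 2 * (ε * k) ^ 2 / τ ^ 2 * n
        = 2 * c ^ 2 * (ε * (k * n)) ^ 2 / (n * τ ^ 2) := by field_simp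
      _ ≤ _ := by
        have := hK n
        have : t ≤ τ := by linarith
        gcongr

/-- Otherwise success and failure at `u n` would both have probability below `1 / 2`. -/
theorem IsFeasibleTime.eventually_fluidTime_sub_le (hc : 0 < c) (hac : ∀ n i, c ≤ a n i)
    (hμ : ∀ n i, 0 < μ n i) (hlam : ∀ n i, IsLoadParameter (a n i) (μ n i) (lam n i))
    (hT : ∀ n (ℓ : Fin n → ℝ), (∀ i, 0 ≤ ℓ i) →
      IsShiftedExpRunTimes (P n) (a n) (μ n) ℓ (T n ℓ))
    (hk : 0 < k) (hK : ∀ n, k * n ≤ returnRate (μ n) (lam n))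
    (hτ : 0 < τ) (hle : ∀ᶠ n in atTop, fluidTime (r n) (μ n) (lam n) ≤ τ)
    {u : ℕ → ℝ} (hu : IsFeasibleTime P r T lam u) {ε : ℝ} (hε : 0 < ε) :
    ∀ᶠ n in atTop, fluidTime (r n) (μ n) (lam n) - ε ≤ u n := by
  obtain ⟨b, hb, hev⟩ := eventually_prob_le_exp hc hac hμ hlam hT hk hK hτ hle hε
  have hp := isLittleO_one_div_nat_iff.1 hu.2
  filter_upwards [hev, eventually_ge_atTop 1, hp.eventually_lt_const (u := 1 / 2) (by norm_num),
    (tendsto_exp_neg_nat hb).eventually_lt_const (u := 1 / 2) (by norm_num)] with n h1 hn h2 h3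
  by_contra! hlt
  have hn1 : (1 : ℝ) ≤ n := by exact_mod_cast hn
  have hload := hcmmLoad_nonneg (fun i => (hlam n i).1) (hu.1 n).le
  have h4 := h1 _ hload (u n) (hu.1 n) hlt.le
  have hmeas := measurable_aggregateReturn (ℓ := hcmmLoad (lam n) (u n))
    (hT n _ hload).measurable (u n)
  have h5 := probReal_compl_eq_one_sub (μ := P n)
    (measurableSet_lt hmeas (measurable_const (a := (r n : ℝ))))
  have h6 : {ω | aggregateReturn (hcmmLoad (lam n) (u n)) (T n (hcmmLoad (lam n) (u n))) (u n) ω <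
      (r n : ℝ)}ᶜ = {ω | (r n : ℝ) ≤
        aggregateReturn (hcmmLoad (lam n) (u n)) (T n (hcmmLoad (lam n) (u n))) (u n) ω} := by
    ext ω; simp
  rw [h6] at h5
  have h7 := measureReal_nonneg (μ := P n) (s := {ω | aggregateReturn (hcmmLoad (lam n) (u n))
    (T n (hcmmLoad (lam n) (u n))) (u n) ω < (r n : ℝ)})
  nlinarith

/-- The margin `(n + 1) ^ (-1/4)` vanishes, yet `n` times its square is of order `√n`, so failure
has probability at most `exp (-b * √(n + 1))`, which is `o(1/n)`. -/
theorem isFeasibleTime_fluidTime_add (hc : 0 < c) (hac : ∀ n i, c ≤ a n i)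
    (hμ : ∀ n i, 0 < μ n i) (hlam : ∀ n i, IsLoadParameter (a n i) (μ n i) (lam n i))
    (hT : ∀ n (ℓ : Fin n → ℝ), (∀ i, 0 ≤ ℓ i) →
      IsShiftedExpRunTimes (P n) (a n) (μ n) ℓ (T n ℓ))
    (hk : 0 < k) (hK : ∀ n, k * n ≤ returnRate (μ n) (lam n))
    (hτ : 0 < τ) (hle : ∀ᶠ n in atTop, fluidTime (r n) (μ n) (lam n) ≤ τ) :
    IsFeasibleTime P r T lam
      fun n => fluidTime (r n) (μ n) (lam n) + 1 / √(√((n : ℝ) + 1)) := by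
  have hδ0 : ∀ n : ℕ, 0 < 1 / √(√((n : ℝ) + 1)) := fun n => by positivity
  have hpos : ∀ n, 0 < fluidTime (r n) (μ n) (lam n) + 1 / √(√((n : ℝ) + 1)) := fun n =>
    add_pos_of_nonneg_of_pos (fluidTime_nonneg hk hK n) (hδ0 n)
  refine ⟨hpos, isLittleO_one_div_nat_iff.2 ?_⟩
  have hb : 0 < c ^ 2 * k ^ 2 / (τ + 1) ^ 2 := by positivity
  refine squeeze_zero' (Eventually.of_forall fun n => by positivity) ?_
    (tendsto_nat_mul_exp_neg_sqrt hb)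
  filter_upwards [hle, eventually_ge_atTop 1] with n hn h1
  have hn1 : (1 : ℝ) ≤ n := by exact_mod_cast h1
  set t := fluidTime (r n) (μ n) (lam n) + 1 / √(√((n : ℝ) + 1)) with ht
  have hrK := fluidTime_mul_returnRate (r := r) hk hK h1
  have hK0 : 0 < returnRate (μ n) (lam n) := lt_of_lt_of_le (by positivity) (hK n)
  have hload := hcmmLoad_nonneg (fun i => (hlam n i).1) (hpos n).le
  have hmean := ((hT n _ hload).integral_aggregateReturn_eq_iff (hμ n) (hlam n) (hpos n) hload).2
    rfl
  change _ = t * returnRate (μ n) (lam n) at hmean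
  have htail := (hT n _ hload).measureReal_aggregateReturn_le_sub_le hload hc (hac n) (hpos n).le
    (s := 1 / √(√((n : ℝ) + 1)) * returnRate (μ n) (lam n)) (by positivity)
  refine mul_le_mul_of_nonneg_left ?_ (by positivity)
  refine (measureReal_mono fun ω (hω : _ < (r n : ℝ)) => ?_).trans
    (htail.trans (Real.exp_le_exp.2 (neg_le_neg ?_)))
  · refine hω.le.trans (le_of_eq ?_)
    rw [hmean, ht, ← hrK]
    ring
  · rw [Fintype.card_fin]
    have hδ1 : 1 / √(√((n : ℝ) + 1)) ≤ 1 := by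
      rw [div_le_one (by positivity), Real.one_le_sqrt, Real.one_le_sqrt]
      linarith
    have htτ : t ≤ τ + 1 := by linarith
    have hsq : √((n : ℝ) + 1) * √((n : ℝ) + 1) = n + 1 := Real.mul_self_sqrt (by positivity)
    have hs0 : 0 < √((n : ℝ) + 1) := by positivity
    have h2 : √((n : ℝ) + 1) ≤ 2 * (n / √((n : ℝ) + 1)) := by
      rw [← mul_div_assoc, le_div_iff₀ hs0, hsq]
      linarith
    calc c ^ 2 * k ^ 2 / (τ + 1) ^ 2 * √((n : ℝ) + 1)
        ≤ c ^ 2 * k ^ 2 / (τ + 1) ^ 2 * (2 * (n / √((n : ℝ) + 1))) := by gcongr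
      _ = 2 * c ^ 2 * (1 / √(√((n : ℝ) + 1)) * (k * n)) ^ 2 / (n * (τ + 1) ^ 2) := by
        rw [mul_pow, div_pow, Real.sq_sqrt hs0.le]
        field_simp
      _ ≤ _ := by
        have := hK n
        have := hpos n
        gcongr

theorem tendsto_one_div_sqrt_sqrt :
    Tendsto (fun n : ℕ => 1 / √(√((n : ℝ) + 1))) atTop (𝓝 0) := by
  have h0 : Tendsto (fun n : ℕ => (n : ℝ) + 1) atTop atTop :=
    tendsto_atTop_add_const_right _ _ tendsto_natCast_atTop_atTop
  simp only [one_div]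
  exact (Real.tendsto_sqrt_atTop.comp (Real.tendsto_sqrt_atTop.comp h0)).inv_tendsto_atTop

/-- The expected finish time of any allocation is at least the fluid time, up to a vanishing
amount. -/
theorem eventually_le_optimalExpectedTime (hc : 0 < c) (hac : ∀ n i, c ≤ a n i)
    (hμ : ∀ n i, 0 < μ n i) (hlam : ∀ n i, IsLoadParameter (a n i) (μ n i) (lam n i))
    (hT : ∀ n (ℓ : Fin n → ℝ), (∀ i, 0 ≤ ℓ i) →
      IsShiftedExpRunTimes (P n) (a n) (μ n) ℓ (T n ℓ))
    (hk : 0 < k) (hK : ∀ n, k * n ≤ returnRate (μ n) (lam n))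
    (hτ : 0 < τ) (hle : ∀ᶠ n in atTop, fluidTime (r n) (μ n) (lam n) ≤ τ)
    {ε : ℝ} (hε : 0 < ε) :
    ∀ᶠ n in atTop, ENNReal.ofReal (fluidTime (r n) (μ n) (lam n) - ε) ≤
      optimalExpectedTime (P n) (r n) (T n) := by
  -- Half of `ε` moves the time before the fluid time; the other half absorbs the loss `t * exp (-(b
  -- * n))` in the Markov-type bound.
  obtain ⟨b, hb, hev⟩ := eventually_prob_le_exp hc hac hμ hlam hT hk hK hτ hle (half_pos hε)
  filter_upwards [hev, hle, (tendsto_exp_neg_nat hb).eventually_lt_const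
    (u := ε / (2 * τ)) (by positivity)] with n h1 h2 h3
  refine le_iInf₂ fun ℓ hℓ => ?_
  rcases le_or_gt (fluidTime (r n) (μ n) (lam n) - ε / 2) 0 with h0 | h0
  · rw [ENNReal.ofReal_of_nonpos (by linarith)]
    exact zero_le
  set t := fluidTime (r n) (μ n) (lam n) - ε / 2 with ht
  have h4 := h1 ℓ hℓ t h0 le_rfl
  have hmeas := measurable_aggregateReturn (ℓ := ℓ) (hT n _ hℓ).measurable t
  have hS : MeasurableSet {ω | aggregateReturn ℓ (T n ℓ) t ω < (r n : ℝ)} :=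
    measurableSet_lt hmeas measurable_const
  have h5 := probReal_compl_eq_one_sub (μ := P n) hS
  have h6 : {ω | aggregateReturn ℓ (T n ℓ) t ω < (r n : ℝ)}ᶜ =
      {ω | (r n : ℝ) ≤ aggregateReturn ℓ (T n ℓ) t ω} := by
    ext ω; simp
  rw [h6] at h5
  calc ENNReal.ofReal (fluidTime (r n) (μ n) (lam n) - ε)
      ≤ ENNReal.ofReal (t * (P n).real {ω | aggregateReturn ℓ (T n ℓ) t ω < (r n : ℝ)}) := by
        apply ENNReal.ofReal_le_ofReal
        have h7 : t * Real.exp (-(b * n)) ≤ τ * (ε / (2 * τ)) := by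
          have : t ≤ τ := by linarith
          gcongr
        have h8 : τ * (ε / (2 * τ)) = ε / 2 := by field_simp
        nlinarith
    _ = ∫⁻ ω, {ω | aggregateReturn ℓ (T n ℓ) t ω < (r n : ℝ)}.indicator
          (fun _ => ENNReal.ofReal t) ω ∂P n := by
        rw [lintegral_indicator_const hS, ENNReal.ofReal_mul h0.le, ofReal_measureReal]
    _ ≤ _ := by
        refine lintegral_mono fun ω => ?_
        refine Set.indicator_le' (fun ω hω => le_finishTime hℓ hω) (fun _ _ => zero_le) ω

/-- The expected finish time of the allocation `t n / lam n i` at a feasible time `t n` exceeds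
`t n` only by a vanishing amount. -/
theorem IsFeasibleTime.eventually_expectedFinishTime_le
    (hc : 0 < c) (ha : ∃ C, ∀ n i, c ≤ a n i ∧ a n i ≤ C)
    (hμ : ∃ d C : ℝ, 0 < d ∧ ∀ n i, d ≤ μ n i ∧ μ n i ≤ C)
    (hlam : ∀ n i, IsLoadParameter (a n i) (μ n i) (lam n i))
    (hT : ∀ n (ℓ : Fin n → ℝ), (∀ i, 0 ≤ ℓ i) →
      IsShiftedExpRunTimes (P n) (a n) (μ n) ℓ (T n ℓ))
    {t : ℕ → ℝ} (ht : IsFeasibleTime P r T lam t) (hτ : 0 < τ) (hle : ∀ᶠ n in atTop, t n ≤ τ)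
    {ε : ℝ} (hε : 0 < ε) :
    ∀ᶠ n in atTop, expectedFinishTime (P n) (r n) (hcmmLoad (lam n) (t n))
      (T n (hcmmLoad (lam n) (t n))) ≤ ENNReal.ofReal (t n + ε) := by
  obtain ⟨C, ha⟩ := ha
  obtain ⟨d, D, hd, hμ⟩ := hμ
  have hp := isLittleO_one_div_nat_iff.1 ht.2
  have hB : 0 < τ / c := by positivity
  have hq := (tendsto_nat_mul_exp_neg (b := d / (τ / c)) (by positivity)).const_mul
    ((τ / c) / d * Real.exp (d / (τ / c) * (C * (τ / c))))
  rw [mul_zero] at hq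
  filter_upwards [hle, hp.eventually_lt_const (half_pos hε), hp.eventually_lt_const one_pos, hq.eventually_lt_const (half_pos hε),
    eventually_ge_atTop 1, tendsto_natCast_atTop_atTop.eventually_ge_atTop (C * (τ / c))]
    with n htτ h1 hp1 h2 hn hnC
  have hn1 : (1 : ℝ) ≤ n := by exact_mod_cast hn
  have htn := ht.1 n
  set ℓ := hcmmLoad (lam n) (t n)
  have hload : ∀ i, 0 ≤ ℓ i := hcmmLoad_nonneg (fun i => (hlam n i).1) htn.le
  have hloadpos : ∀ i, 0 < ℓ i := fun i => div_pos htn (hlam n i).1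
  have hRT := hT n ℓ hload
  have hS : MeasurableSet {ω | aggregateReturn ℓ (T n ℓ) (t n) ω < (r n : ℝ)} :=
    measurableSet_lt (measurable_aggregateReturn hRT.measurable _) measurable_const
  set A := {ω | aggregateReturn ℓ (T n ℓ) (t n) ω < (r n : ℝ)}
  -- With a smaller total load failure would be certain, against `n * P(A) < 1`.
  have hsum : (r n : ℝ) ≤ ∑ i, ℓ i := by
    by_contra! hlt
    have hAuniv : A = Set.univ := Set.eq_univ_of_forall fun ω =>
      (aggregateReturn_le_sum hload _ ω).trans_lt hlt
    rw [hAuniv, probReal_univ] at hp1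
    linarith
  have hℓB : ∀ i, ℓ i ≤ τ / c := fun i =>
    div_le_div₀ hτ.le htτ hc ((ha n i).1.trans ((hlam n i).lt (hd.trans_le (hμ n i).1)).le)
  have hlate : ∀ i, ∫⁻ ω, ENNReal.ofReal (T n ℓ i ω - n) ∂P n ≤
      ENNReal.ofReal ((τ / c) / d * Real.exp (-(d / (τ / c)) * (n - C * (τ / c)))) := by
    intro i
    have hμi : 0 < μ n i := hd.trans_le (hμ n i).1
    have hai : 0 < a n i := hc.trans_le (ha n i).1
    have haℓ : a n i * ℓ i ≤ C * (τ / c) :=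
      mul_le_mul (ha n i).2 (hℓB i) (hload i) (hai.le.trans (ha n i).2)
    refine (hRT.lintegral_sub_le hμi (hloadpos i) (haℓ.trans hnC)).trans
      (ENNReal.ofReal_le_ofReal ?_)
    have h3 : ℓ i / μ n i ≤ (τ / c) / d := div_le_div₀ hB.le (hℓB i) hd (hμ n i).1
    have h4 : d / (τ / c) ≤ μ n i / ℓ i := div_le_div₀ hμi.le (hμ n i).1 (hloadpos i) (hℓB i)
    have h5 : d / (τ / c) * (n - C * (τ / c)) ≤ μ n i / ℓ i * (n - a n i * ℓ i) :=
      mul_le_mul h4 (by linarith) (by linarith) (div_pos hμi (hloadpos i)).le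
    refine mul_le_mul h3 (Real.exp_le_exp.2 (by linarith)) (Real.exp_pos _).le (by positivity)
  have hexp : Real.exp (-(d / (τ / c)) * (n - C * (τ / c))) =
      Real.exp (d / (τ / c) * (C * (τ / c))) * Real.exp (-(d / (τ / c) * n)) := by
    rw [← Real.exp_add]; ring_nf
  -- The cutoff is `M = n`: the `o(1/n)` failure probability pays for it, and the tails beyond it
  -- stay negligible after summing over `n` workers.
  calc expectedFinishTime (P n) (r n) ℓ (T n ℓ)
      ≤ ∫⁻ ω, (ENNReal.ofReal (t n) + A.indicator (fun _ => ENNReal.ofReal n) ω +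
          ∑ i, ENNReal.ofReal (T n ℓ i ω - n)) ∂P n :=
        lintegral_mono fun ω => finishTime_le_add hsum htn.le (Nat.cast_nonneg n) ω
    _ = ENNReal.ofReal (t n) + ENNReal.ofReal (n * (P n).real A) +
          ∑ i, ∫⁻ ω, ENNReal.ofReal (T n ℓ i ω - n) ∂P n := by
        have hm : Measurable fun ω => ENNReal.ofReal (t n) +
            A.indicator (fun _ => ENNReal.ofReal n) ω :=
          (measurable_const.indicator hS).const_add _
        rw [lintegral_add_left hm, lintegral_add_left measurable_const, lintegral_const, measure_univ, mul_one,
          lintegral_indicator_const hS, ENNReal.ofReal_mul (Nat.cast_nonneg n),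
          ofReal_measureReal, lintegral_finsetSum]
        intro i _
        exact ((hRT.measurable i).sub_const _).ennreal_ofReal
    _ ≤ ENNReal.ofReal (t n) + ENNReal.ofReal (n * (P n).real A) +
          ∑ _i : Fin n, ENNReal.ofReal
            ((τ / c) / d * Real.exp (-(d / (τ / c)) * (n - C * (τ / c)))) := by
        gcongr with i
        exact hlate i
    _ = ENNReal.ofReal (t n + n * (P n).real A +
          n * ((τ / c) / d * Real.exp (-(d / (τ / c)) * (n - C * (τ / c))))) := by
        rw [ENNReal.ofReal_add (by positivity) (by positivity),
          ENNReal.ofReal_add htn.le (by positivity), Finset.sum_const, Finset.card_univ,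
          Fintype.card_fin, nsmul_eq_mul, ENNReal.ofReal_mul (Nat.cast_nonneg n),
          ENNReal.ofReal_mul (Nat.cast_nonneg n), ENNReal.ofReal_natCast]
    _ ≤ ENNReal.ofReal (t n + ε) := by
        apply ENNReal.ofReal_le_ofReal
        rw [hexp]
        have h6 : (n : ℝ) * ((τ / c) / d * (Real.exp (d / (τ / c) * (C * (τ / c))) *
            Real.exp (-(d / (τ / c) * n)))) = (τ / c) / d *
            Real.exp (d / (τ / c) * (C * (τ / c))) * (n * Real.exp (-(d / (τ / c) * n))) := by
          ring
        linarith

end Sequences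

end HCMM
-- Squeezing both expectations to the fluid time.
theorem theorem1
    {Ω : ℕ → Type*} [∀ n, MeasurableSpace (Ω n)] (P : ∀ n, Measure (Ω n))
    [∀ n, IsProbabilityMeasure (P n)]
    (a μ : ∀ n, Fin n → ℝ) (r : ℕ → ℕ)
    (ha : ∃ c C : ℝ, 0 < c ∧ ∀ n i, c ≤ a n i ∧ a n i ≤ C)
    (hμ : ∃ c C : ℝ, 0 < c ∧ ∀ n i, c ≤ μ n i ∧ μ n i ≤ C)
    (hr : (fun n => (r n : ℝ)) =Θ[atTop] fun n => (n : ℝ))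
    (T : ∀ n, (Fin n → ℝ) → Fin n → Ω n → ℝ)
    (hT : ∀ n (ℓ : Fin n → ℝ), (∀ i, 0 ≤ ℓ i) →
      HCMM.IsShiftedExpRunTimes (P n) (a n) (μ n) ℓ (T n ℓ)) :
    (∀ n i, ∃! x : ℝ, HCMM.IsLoadParameter (a n i) (μ n i) x) ∧
    ∀ lam : ∀ n, Fin n → ℝ, (∀ n i, HCMM.IsLoadParameter (a n i) (μ n i) (lam n i)) →
      (∀ n (t : ℝ), 0 < t → ∀ ℓ : Fin n → ℝ,
        HCMM.MaximizesReturn (P n) (T n) t ℓ ↔ ℓ = HCMM.hcmmLoad (lam n) t) ∧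
      (∃ tstar : ℕ → ℝ, HCMM.IsMinimalTime P r T lam tstar) ∧
      ∀ tstar : ℕ → ℝ, HCMM.IsMinimalTime P r T lam tstar →
        (∀ᶠ n in atTop,
          HCMM.expectedFinishTime (P n) (r n) (HCMM.hcmmLoad (lam n) (tstar n))
            (T n (HCMM.hcmmLoad (lam n) (tstar n))) ≠ ∞ ∧
          HCMM.optimalExpectedTime (P n) (r n) (T n) ≠ ∞) ∧
        Tendsto (fun n =>
          (HCMM.expectedFinishTime (P n) (r n) (HCMM.hcmmLoad (lam n) (tstar n))
            (T n (HCMM.hcmmLoad (lam n) (tstar n)))).toReal -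
          (HCMM.optimalExpectedTime (P n) (r n) (T n)).toReal) atTop (𝓝 0) ∧
        ∀ ℓopt : ∀ n, Fin n → ℝ,
          (∀ n, HCMM.IsOptimalAllocation (P n) (r n) (T n) (ℓopt n)) →
          Tendsto (fun n =>
            (HCMM.expectedFinishTime (P n) (r n) (HCMM.hcmmLoad (lam n) (tstar n))
              (T n (HCMM.hcmmLoad (lam n) (tstar n)))).toReal -
            (HCMM.expectedFinishTime (P n) (r n) (ℓopt n) (T n (ℓopt n))).toReal)
            atTop (𝓝 0) := by
  obtain ⟨c, C, hc, ha⟩ := ha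
  have haC : ∃ C, ∀ n i, c ≤ a n i ∧ a n i ≤ C := ⟨C, ha⟩
  have hac : ∀ n i, c ≤ a n i := fun n i => (ha n i).1
  have hμ0 : ∀ n i, 0 < μ n i := by
    obtain ⟨d, D, hd, h⟩ := hμ
    exact fun n i => hd.trans_le (h n i).1
  refine ⟨fun n i => HCMM.existsUnique_isLoadParameter (hc.trans_le (hac n i)) (hμ0 n i),
    fun lam hlam => ?_⟩
  obtain ⟨k, hk, hK⟩ := HCMM.exists_mul_le_returnRate ⟨c, C, hc, ha⟩ hμ hlam
  obtain ⟨τ, hτ, hle⟩ := HCMM.exists_fluidTime_le hk hK hr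
  have hlower : ∀ u : ℕ → ℝ, HCMM.IsFeasibleTime P r T lam u → ∀ ε : ℝ, 0 < ε →
      ∀ᶠ n in atTop, HCMM.fluidTime (r n) (μ n) (lam n) - ε ≤ u n := fun u hu ε hε =>
    hu.eventually_fluidTime_sub_le hc hac hμ0 hlam hT hk hK hτ hle hε
  have hfeas := HCMM.isFeasibleTime_fluidTime_add hc hac hμ0 hlam hT hk hK hτ hle
  refine ⟨fun n t ht ℓ => HCMM.maximizesReturn_iff (hT n) (hμ0 n) (hlam n) ht,
    ⟨_, hfeas, fun u hu ε hε => ?_⟩, fun tstar ht => ?_⟩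
  -- The fluid time plus `(n + 1) ^ (-1/4)` is itself a minimal sequence.
  · filter_upwards [hlower u hu _ (half_pos hε),
      HCMM.tendsto_one_div_sqrt_sqrt.eventually_lt_const (half_pos hε)] with n h1 h2
    linarith
  have hupper : ∀ ε : ℝ, 0 < ε →
      ∀ᶠ n in atTop, tstar n ≤ HCMM.fluidTime (r n) (μ n) (lam n) + ε := by
    intro ε hε
    filter_upwards [ht.2 _ hfeas _ (half_pos hε),
      HCMM.tendsto_one_div_sqrt_sqrt.eventually_lt_const (half_pos hε)] with n h1 h2
    linarith
  have htstar : ∀ᶠ n in atTop, tstar n ≤ τ + 1 := by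
    filter_upwards [hupper 1 one_pos, hle] with n h1 h2
    linarith
  have hopt_le : ∀ n, HCMM.optimalExpectedTime (P n) (r n) (T n) ≤
      HCMM.expectedFinishTime (P n) (r n) (HCMM.hcmmLoad (lam n) (tstar n))
        (T n (HCMM.hcmmLoad (lam n) (tstar n))) := fun n =>
    iInf₂_le _ (HCMM.hcmmLoad_nonneg (fun i => (hlam n i).1) (ht.1.1 n).le)
  have hHCMM : ∀ ε : ℝ, 0 < ε → ∀ᶠ n in atTop,
      HCMM.expectedFinishTime (P n) (r n) (HCMM.hcmmLoad (lam n) (tstar n))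
        (T n (HCMM.hcmmLoad (lam n) (tstar n))) ≤ ENNReal.ofReal (tstar n + ε) := fun ε hε =>
    ht.1.eventually_expectedFinishTime_le hc haC hμ hlam hT (by positivity) htstar hε
  have hlim : Tendsto (fun n =>
      (HCMM.expectedFinishTime (P n) (r n) (HCMM.hcmmLoad (lam n) (tstar n))
        (T n (HCMM.hcmmLoad (lam n) (tstar n)))).toReal -
      (HCMM.optimalExpectedTime (P n) (r n) (T n)).toReal) atTop (𝓝 0) := by
    rw [Metric.tendsto_nhds]
    intro ε hε
    -- Three errors of `ε / 4`: HCMM above `tstar`, `tstar` above the fluid time, and the optimum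
    -- below it.
    have h4 : 0 < ε / 4 := by positivity
    filter_upwards [hHCMM _ h4, hupper _ h4,
      HCMM.eventually_le_optimalExpectedTime hc hac hμ0 hlam hT hk hK hτ hle h4] with n h1 h2 h3
    have hfin := ne_top_of_le_ne_top ENNReal.ofReal_ne_top h1
    have h5 := ENNReal.toReal_mono hfin (hopt_le n)
    have h6 := ENNReal.toReal_le_of_le_ofReal (add_pos (ht.1.1 n) h4).le h1
    have h7 := (ENNReal.ofReal_le_iff_le_toReal (ne_top_of_le_ne_top hfin (hopt_le n))).1 h3
    rw [Real.dist_eq, sub_zero, abs_lt]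
    constructor <;> linarith
  refine ⟨?_, hlim, fun ℓopt hopt => ?_⟩
  · filter_upwards [hHCMM 1 one_pos] with n h1
    have hfin := ne_top_of_le_ne_top ENNReal.ofReal_ne_top h1
    exact ⟨hfin, ne_top_of_le_ne_top hfin (hopt_le n)⟩
  · have heq : ∀ n, HCMM.expectedFinishTime (P n) (r n) (ℓopt n) (T n (ℓopt n)) =
        HCMM.optimalExpectedTime (P n) (r n) (T n) := fun n =>
      le_antisymm (le_iInf₂ (hopt n).2) (iInf₂_le _ (hopt n).1)
    simpa only [heq] using hlim
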